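/- Let $f$ be a real- or complex-valued absolutely continuous function on $[-1,1]$ whose (almost everywhere existing) derivative satisfies $\|f'\|_{L^\infty[-1,1]}\le 1$. Then for every integer $n\ge 2$ there is an algebraic polynomial $P_n$ of degree at most $n$ (with real coefficients if $f$ is real-valued) such that for all $x\in[-1,1]$ $$|f(x)-P_n(x)|\le \tan\frac{\pi}{2n}\,\sqrt{1-x^2}+\Bigl(\sec\frac{\pi}{2n}-1\Bigr)\sqrt{x^2}.$$ -/

import Mathlib

open Set MeasureTheory
open scoped ENNReal

/-- The space `W¹` of the interval `[-1, 1]`: absolutely continuous functions whose derivative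
(which exists almost everywhere) is essentially bounded. Only the values of `f` on `[-1, 1]`
matter. -/
def MemW1 {𝕜 : Type*} [RCLike 𝕜] (f : ℝ → 𝕜) : Prop :=
  AbsolutelyContinuousOnInterval f (-1) 1 ∧
    eLpNorm (deriv f) ∞ (volume.restrict (Icc (-1 : ℝ) 1)) < ∞

/-- The norm `‖f‖_{W¹} = ‖f'‖_{L^∞[-1, 1]}`, the essential supremum of `|f'|` over `[-1, 1]`. -/
noncomputable def w1Norm {𝕜 : Type*} [RCLike 𝕜] (f : ℝ → 𝕜) : ℝ≥0∞ :=
  eLpNorm (deriv f) ∞ (volume.restrict (Icc (-1 : ℝ) 1))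

/-! Put `x = cos t` and let `F` be a bounded version of `f'`. Up to a constant, `f (cos t)` is
`-1/π` times the integral over `[-π, π]` of `sawtooth (t - τ) * sin τ * F (cos τ)`. Since `sin τ =
sin t cos (t - τ) - cos t sin (t - τ)`, the kernel splits into `sin t` times `sawtooth * cos` and
`cos t` times `sawtooth * sin`, both evaluated at `t - τ`. Replacing the first by a sine polynomial
and the second by a cosine polynomial, each of order below `n`, turns the integral into an algebraic
polynomial in `cos t` of degree at most `n`, because `F ∘ cos` is even. As `|F| ≤ 1`, the error is
at most `1/π` times the two `L¹` errors weighted by `sin t = √(1 - x²)` and `|cos t|`.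

It remains to find approximants with `L¹` errors `π tan (π/2n)` and `π (sec (π/2n) - 1)`
(`exists_sine_polynomial`, `exists_cosine_polynomial`). They interpolate at the zeros of `sin (n s)`
and `cos (n s)`, and the error changes sign exactly with these functions: the factor `(π - s) / (2
sin s)` is an integral of Cauchy kernels `1 / (a - cos s)` with `a ≥ 1`, whose interpolation errors
are explicit (`interpolate_error_mul_nodal_nonneg`). Given the signs, `∫ |D|` folds to an integral
over `[0, π/n]` of an alternating sum of shifts, which annihilates trigonometric polynomials of
order below `n` and is explicit on the sawtooth part (`integral_abs_sawtooth_sub`). -/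

/-! ### Interpolation errors for Cauchy kernels and their Poisson-type average. -/

open Polynomial in
/-- The error of Lagrange interpolation of `y ↦ w y / (a - y)`. -/
theorem div_sub_interpolate_eq (S : Finset ℝ) (w : ℝ[X]) (hw : w.natDegree ≤ S.card) {a x : ℝ}
    (ha : a ∉ S) (hx : x ≠ a) :
    w.eval x / (a - x) - (Lagrange.interpolate S id (fun y => w.eval y / (a - y))).eval x
      = w.eval a * (Lagrange.nodal S id).eval x / ((Lagrange.nodal S id).eval a * (a - x)) := by
  set N := Lagrange.nodal S (id : ℝ → ℝ) with hN
  have hNa : N.eval a ≠ 0 := by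
    refine Lagrange.eval_nodal_not_at_node fun i hi h => ha ?_
    rw [h]; exact hi
  have hax : a - x ≠ 0 := sub_ne_zero.2 hx.symm
  -- The combination vanishes at `a`; its quotient `Q`, divided by `N(a)`, has degree below `S.card`
  -- and takes the values `w y / (a - y)` at the nodes, so it is the interpolant.
  have hdvd : (X - C a) ∣ (C (w.eval a) * N - C (N.eval a) * w) := by
    rw [dvd_iff_isRoot]; simp [IsRoot.def]; ring
  obtain ⟨Q, hQ⟩ := hdvd
  have hQe : ∀ y, (a - y) * Q.eval y = N.eval a * w.eval y - w.eval a * N.eval y := by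
    intro y
    have := congrArg (eval y) hQ
    simp at this
    linarith
  have hdeg : Q.degree < S.card := by
    by_cases hQ0 : Q = 0
    · rw [hQ0, degree_zero]; exact WithBot.bot_lt_coe _
    have h1 : ((X - C a) * Q).natDegree ≤ S.card := by
      rw [← hQ]
      refine (natDegree_sub_le _ _).trans (max_le ?_ ?_)
      · exact (natDegree_C_mul_le _ _).trans (by rw [hN, Lagrange.natDegree_nodal])
      · exact (natDegree_C_mul_le _ _).trans hw
    rw [natDegree_mul (X_sub_C_ne_zero a) hQ0, natDegree_X_sub_C] at h1
    rw [degree_eq_natDegree hQ0]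
    exact_mod_cast (by omega : Q.natDegree < S.card)
  have hint : C (N.eval a)⁻¹ * Q = Lagrange.interpolate S id (fun y => w.eval y / (a - y)) := by
    refine Lagrange.eq_interpolate_of_eval_eq _ (Function.injective_id.injOn) ?_ ?_
    · exact lt_of_le_of_lt (by rw [degree_C_mul (inv_ne_zero hNa)]) hdeg
    · intro i hi
      have hai : a - i ≠ 0 := sub_ne_zero.2 (fun h => ha (h ▸ hi))
      have h := hQe i
      have h0 : N.eval i = 0 := Lagrange.eval_nodal_at_node (v := id) hi
      rw [h0, mul_zero, sub_zero] at h
      simp only [eval_mul, eval_C, id]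
      field_simp
      linarith
  rw [← hint, eval_mul, eval_C]
  have h := hQe x
  field_simp
  linear_combination (-1) * h

/-- The Poisson type integral `∫₀¹ dr / (1 - 2 r x + r²)`. -/
noncomputable def poissonIntegral (x : ℝ) : ℝ := ∫ r in (0 : ℝ)..1, (1 - 2 * r * x + r ^ 2)⁻¹

theorem one_sub_two_mul_add_sq_pos {x r : ℝ} (hx : x ∈ Ioo (-1 : ℝ) 1) :
    0 < 1 - 2 * r * x + r ^ 2 := by
  nlinarith [sq_nonneg (r - x), hx.1, hx.2]

theorem cos_mem_Ioo {s : ℝ} (hs : s ∈ Ioo 0 Real.pi) : Real.cos s ∈ Ioo (-1 : ℝ) 1 := by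
  have := Real.sin_sq_add_cos_sq s
  have := Real.sin_pos_of_mem_Ioo hs
  constructor <;> nlinarith [Real.neg_one_le_cos s, Real.cos_le_one s]

theorem poissonIntegral_cos {s : ℝ} (hs : s ∈ Ioo 0 Real.pi) :
    poissonIntegral (Real.cos s) = (Real.pi - s) / (2 * Real.sin s) := by
  have hsin : 0 < Real.sin s := Real.sin_pos_of_mem_Ioo hs
  have hcos := cos_mem_Ioo hs
  -- Completing the square, the denominator is `(r - cos s)² + sin² s`, which gives an arctangent
  -- primitive.
  have hd : ∀ r ∈ uIcc (0 : ℝ) 1,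
      HasDerivAt (fun r => Real.arctan ((r - Real.cos s) / Real.sin s) / Real.sin s)
        ((1 - 2 * r * Real.cos s + r ^ 2)⁻¹) r := by
    intro r _
    have h := ((((hasDerivAt_id r).sub_const (Real.cos s)).div_const (Real.sin s)).arctan).div_const
      (Real.sin s)
    refine h.congr_deriv ?_
    have hp := one_sub_two_mul_add_sq_pos (r := r) hcos
    have h2 : Real.sin s ^ 2 + (r - Real.cos s) ^ 2 = 1 - 2 * r * Real.cos s + r ^ 2 := by
      linear_combination Real.sin_sq_add_cos_sq s
    have h3 : 0 < Real.sin s ^ 2 + (r - Real.cos s) ^ 2 := by rw [h2]; exact hp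
    rw [← h2]
    simp only [id]
    field_simp
  rw [poissonIntegral, intervalIntegral.integral_eq_sub_of_hasDerivAt hd]
  · have e1 : Real.arctan ((1 - Real.cos s) / Real.sin s) = s / 2 := by
      have : (1 - Real.cos s) / Real.sin s = Real.tan (s / 2) := by
        have h2 : s = 2 * (s / 2) := by ring
        have hc : Real.cos (s / 2) ≠ 0 := (Real.cos_pos_of_mem_Ioo
          ⟨by linarith [hs.1, Real.pi_pos], by linarith [hs.2]⟩).ne'
        have hs' : Real.sin (s / 2) ≠ 0 := (Real.sin_pos_of_mem_Ioo
          ⟨by linarith [hs.1], by linarith [hs.2, Real.pi_pos]⟩).ne'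
        rw [Real.tan_eq_sin_div_cos]
        conv_lhs => rw [h2, Real.cos_two_mul, Real.sin_two_mul]
        field_simp
        linear_combination (-2) * Real.sin_sq_add_cos_sq (s / 2)
      rw [this, Real.arctan_tan] <;> linarith [hs.1, hs.2, Real.pi_pos]
    have e0 : Real.arctan ((0 - Real.cos s) / Real.sin s) = s - Real.pi / 2 := by
      have : (0 - Real.cos s) / Real.sin s = Real.tan (s - Real.pi / 2) := by
        rw [Real.tan_eq_sin_div_cos, Real.sin_sub_pi_div_two, Real.cos_sub_pi_div_two, zero_sub]
      rw [this, Real.arctan_tan] <;> linarith [hs.1, hs.2, Real.pi_pos]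
    rw [e1, e0]
    field_simp
    ring
  · refine ContinuousOn.intervalIntegrable fun r _ => ContinuousAt.continuousWithinAt ?_
    exact ContinuousAt.inv₀ (by fun_prop) (one_sub_two_mul_add_sq_pos hcos).ne'

-- Interpolation is linear, so the error is the integral over `r` of the errors for `w y / (a - y)`.
-- Each equals `w(a) N(x) / (N(a) (a - x))` up to a positive factor, and `w(a) ≥ 0`, `N(a) > 0`, `a
-- > x`, so all share the sign of `N(x)`.
open Polynomial in
theorem interpolate_error_mul_nodal_nonneg (S : Finset ℝ) (hS : ∀ y ∈ S, y ∈ Ioo (-1 : ℝ) 1)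
    (w : ℝ[X]) (hw : w.natDegree ≤ S.card) (hw0 : ∀ a, 1 ≤ a → 0 ≤ w.eval a) {x : ℝ}
    (hx : x ∈ Ioo (-1 : ℝ) 1) :
    0 ≤ (w.eval x * poissonIntegral x
      - (Lagrange.interpolate S id (fun y => w.eval y * poissonIntegral y)).eval x)
        * (Lagrange.nodal S id).eval x := by
  have hint : ∀ y ∈ Ioo (-1 : ℝ) 1,
      IntervalIntegrable (fun r : ℝ => (1 - 2 * r * y + r ^ 2)⁻¹) volume 0 1 := fun y hy => by
    refine ContinuousOn.intervalIntegrable fun r _ => ContinuousAt.continuousWithinAt ?_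
    exact ContinuousAt.inv₀ (by fun_prop) (one_sub_two_mul_add_sq_pos hy).ne'
  have hI : (Lagrange.interpolate S id (fun y => w.eval y * poissonIntegral y)).eval x
      = ∫ r in (0 : ℝ)..1,
        (Lagrange.interpolate S id (fun y => w.eval y * (1 - 2 * r * y + r ^ 2)⁻¹)).eval x := by
    simp only [Lagrange.interpolate_apply, eval_finsetSum, eval_mul, eval_C]
    rw [intervalIntegral.integral_finsetSum]
    · refine Finset.sum_congr rfl fun i hi => ?_
      rw [intervalIntegral.integral_mul_const, intervalIntegral.integral_const_mul]
      rfl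
    · intro i hi
      exact ((hint i (hS i hi)).const_mul _).mul_const _
  have hII : IntervalIntegrable (fun r : ℝ =>
      (Lagrange.interpolate S id (fun y => w.eval y * (1 - 2 * r * y + r ^ 2)⁻¹)).eval x)
      volume 0 1 := by
    simp only [Lagrange.interpolate_apply, eval_finsetSum, eval_mul, eval_C]
    have := IntervalIntegrable.sum S (μ := volume) (a := (0 : ℝ)) (b := 1)
      (f := fun i r => w.eval i * (1 - 2 * r * i + r ^ 2)⁻¹ * (Lagrange.basis S id i).eval x)
      (fun i hi => ((hint i (hS i hi)).const_mul _).mul_const _)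
    simpa only [Finset.sum_fn] using this
  rw [hI, poissonIntegral, ← intervalIntegral.integral_const_mul,
    ← intervalIntegral.integral_sub ((hint x hx).const_mul _) hII,
    ← intervalIntegral.integral_mul_const, intervalIntegral.integral_of_le zero_le_one]
  refine setIntegral_nonneg measurableSet_Ioc fun r hr => ?_
  have hr0 : 0 < r := hr.1
  -- This is the pole in `y` of `1 / (1 - 2 r y + r²)`; it is at least `1` by AM-GM.
  set a := (1 + r ^ 2) / (2 * r) with ha
  have ha1 : 1 ≤ a := by
    rw [ha, le_div_iff₀ (by positivity)]; nlinarith [sq_nonneg (r - 1)]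
  have hq : ∀ y, (1 - 2 * r * y + r ^ 2)⁻¹ = (2 * r)⁻¹ * (a - y)⁻¹ := by
    intro y
    rw [← mul_inv, ha]; congr 1; field_simp; ring
  have haS : a ∉ S := fun h => by linarith [(hS a h).2]
  have hxa : x ≠ a := by intro h; linarith [hx.2]
  have key := div_sub_interpolate_eq S w hw haS hxa
  have hlin : Lagrange.interpolate S id (fun y => w.eval y * (1 - 2 * r * y + r ^ 2)⁻¹)
      = (2 * r)⁻¹ • Lagrange.interpolate S id (fun y => w.eval y / (a - y)) := by
    rw [← map_smul]
    congr 1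
    ext y
    simp only [hq, Pi.smul_apply, smul_eq_mul]
    ring
  have hNa : 0 < (Lagrange.nodal S id).eval a := by
    rw [Lagrange.eval_nodal]
    exact Finset.prod_pos fun i hi => by simp only [id]; linarith [(hS i hi).2]
  have : (w.eval x * (1 - 2 * r * x + r ^ 2)⁻¹ - (Lagrange.interpolate S id
      (fun y => w.eval y * (1 - 2 * r * y + r ^ 2)⁻¹)).eval x) * (Lagrange.nodal S id).eval x
      = (2 * r)⁻¹ * (w.eval a * (Lagrange.nodal S id).eval x ^ 2
        / ((Lagrange.nodal S id).eval a * (a - x))) := by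
    rw [hlin, hq, eval_smul, smul_eq_mul]
    linear_combination (2 * r)⁻¹ * (Lagrange.nodal S id).eval x * key
  rw [this]
  have := hw0 a ha1
  have : 0 < a - x := by linarith [hx.2]
  positivity

open Polynomial in
theorem exists_eq_sum_of_natDegree_eq {p : ℕ → ℝ[X]} (hp : ∀ k, (p k).degree = k) (m : ℕ)
    (V : ℝ[X]) (hV : V.degree < m) :
    ∃ v : ℕ → ℝ, V = ∑ k ∈ Finset.range m, C (v k) * p k := by
  induction m generalizing V with
  | zero =>
    have : V = 0 := by
      rw [← degree_eq_bot]
      by_contra h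
      rw [degree_eq_natDegree (by simpa using h)] at hV
      norm_cast at hV
    exact ⟨0, by simp [this]⟩
  | succ m ih =>
    set c := V.coeff m / (p m).leadingCoeff with hc
    have hlc : (p m).leadingCoeff ≠ 0 := by
      rw [leadingCoeff_ne_zero]; intro h; have := hp m; rw [h] at this; simp at this
    have hnd : (p m).natDegree = m := natDegree_eq_of_degree_eq_some (hp m)
    have hlow : (V - C c * p m).degree < m := by
      rw [degree_lt_iff_coeff_zero]
      intro k hk
      rcases hk.eq_or_lt with rfl | hk
      · have : (p m).coeff m = (p m).leadingCoeff := by rw [leadingCoeff, hnd]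
        simp [hc, this, hlc]
      · rw [coeff_sub, coeff_C_mul, coeff_eq_zero_of_natDegree_lt (p := p m) (by omega),
          coeff_eq_zero_of_degree_lt (lt_of_lt_of_le hV (by exact_mod_cast hk))]
        simp
    obtain ⟨v, hv⟩ := ih _ hlow
    refine ⟨Function.update v m c, ?_⟩
    rw [Finset.sum_range_succ, Function.update_self]
    have : ∑ k ∈ Finset.range m, C (Function.update v m c k) * p k
        = ∑ k ∈ Finset.range m, C (v k) * p k := by
      refine Finset.sum_congr rfl fun k hk => ?_
      rw [Function.update_of_ne (Finset.mem_range.1 hk).ne]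
    rw [this, ← hv]
    ring

/-! ### Alternating sums over shifts by `π/n`. -/

theorem two_cos_mul_alternating_sum (α β : ℝ) (N : ℕ) :
    2 * Real.cos β * ∑ k ∈ Finset.range N, (-1 : ℝ) ^ k * Real.cos (α + 2 * k * β)
      = Real.cos (α - β) - (-1) ^ N * Real.cos (α - β + 2 * N * β) := by
  induction N with
  | zero => simp
  | succ N ih =>
    rw [Finset.sum_range_succ, mul_add, ih]
    have h1 : Real.cos (α - β + 2 * N * β) = _ := (by congr 1; ring :
      _ = Real.cos ((α + 2 * N * β) - β)).trans (Real.cos_sub _ _)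
    have h2 : Real.cos (α - β + 2 * (N + 1 : ℕ) * β) = _ := (by
      congr 1; push_cast; ring : _ = Real.cos ((α + 2 * N * β) + β)).trans (Real.cos_add _ _)
    rw [h1, h2]
    ring

theorem two_cos_mul_weighted_alternating_sum (α β : ℝ) (N : ℕ) :
    2 * Real.cos β * ∑ k ∈ Finset.range N, (-1 : ℝ) ^ k * (k * Real.cos (α + 2 * k * β))
      = ∑ k ∈ Finset.range N, (-1 : ℝ) ^ k * Real.cos (α - β + 2 * k * β)
        - Real.cos (α - β) - (-1) ^ N * (N - 1) * Real.cos (α - β + 2 * N * β) := by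
  induction N with
  | zero => simp
  | succ N ih =>
    rw [Finset.sum_range_succ, mul_add, ih, Finset.sum_range_succ]
    have h1 : Real.cos (α - β + 2 * N * β) = _ := (by congr 1; ring :
      _ = Real.cos ((α + 2 * N * β) - β)).trans (Real.cos_sub _ _)
    have h2 : Real.cos (α - β + 2 * (N + 1 : ℕ) * β) = _ := (by
      congr 1; push_cast; ring : _ = Real.cos ((α + 2 * N * β) + β)).trans (Real.cos_add _ _)
    rw [h1, h2]
    push_cast
    ring

theorem alternating_sum_cos_eq_zero {n m : ℕ} (hm : m < n) (α : ℝ) :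
    ∑ k ∈ Finset.range (2 * n),
      (-1 : ℝ) ^ k * Real.cos (α + 2 * k * (m * (Real.pi / (2 * n)))) = 0 := by
  have hn : (0 : ℝ) < n := by exact_mod_cast (by omega : 0 < n)
  have hc : 0 < Real.cos (m * (Real.pi / (2 * n))) := by
    refine Real.cos_pos_of_mem_Ioo ⟨?_, ?_⟩
    · have : 0 ≤ m * (Real.pi / (2 * n)) := by positivity
      linarith [Real.pi_pos]
    · have : (m : ℝ) < n := by exact_mod_cast hm
      rw [← mul_div_assoc, div_lt_div_iff₀ (by positivity) (by positivity)]
      nlinarith [Real.pi_pos, mul_lt_mul_of_pos_right this Real.pi_pos]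
  have h := two_cos_mul_alternating_sum α (m * (Real.pi / (2 * n))) (2 * n)
  -- The `2n` shifts cover whole periods, so the two boundary terms of the telescoped sum cancel; `m
  -- < n` allows division by `cos (m π / 2n)`.
  have e : 2 * ((2 * n : ℕ) : ℝ) * (m * (Real.pi / (2 * n))) = m * (2 * Real.pi) := by
    push_cast; field_simp
  rw [e, Real.cos_add_nat_mul_two_pi, pow_mul] at h
  norm_num at h
  rcases h with h | h
  · exact absurd h hc.ne'
  · simpa using h

/-- The part of the linear factor constant in `k` contributes zero since the frequency `1` is below
`n`; only the boundary term of the weighted sum survives. The phases `φ = 0` and `φ = π/2` serve the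
cosine and sine kernels. -/
theorem alternating_sum_sawtooth {n : ℕ} (hn : 2 ≤ n) (s φ : ℝ) :
    ∑ k ∈ Finset.range (2 * n), (-1 : ℝ) ^ k *
        ((Real.pi - (s + 2 * k * (Real.pi / (2 * n)))) / 2
          * Real.cos (s + 2 * k * (Real.pi / (2 * n)) - φ))
      = Real.pi * Real.cos (s - Real.pi / (2 * n) - φ) / (2 * Real.cos (Real.pi / (2 * n))) := by
  have hn0 : (2 : ℝ) ≤ n := by exact_mod_cast hn
  set δ := Real.pi / (2 * n) with hδ
  have hc : 0 < Real.cos δ := by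
    refine Real.cos_pos_of_mem_Ioo ⟨?_, ?_⟩
    · have : 0 < δ := by have := Real.pi_pos; positivity
      linarith [Real.pi_pos]
    · rw [hδ, div_lt_div_iff₀ (by positivity) (by positivity)]
      nlinarith [Real.pi_pos]
  have h1 : ∀ α, ∑ k ∈ Finset.range (2 * n), (-1 : ℝ) ^ k * Real.cos (α + 2 * k * δ) = 0 := by
    intro α
    have := alternating_sum_cos_eq_zero (n := n) (m := 1) (by omega) α
    simpa using this
  have h2 := two_cos_mul_weighted_alternating_sum (s - φ) δ (2 * n)
  have e : 2 * ((2 * n : ℕ) : ℝ) * δ = 2 * Real.pi := by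
    rw [hδ]; push_cast; field_simp
  rw [h1, e, Real.cos_add_two_pi, pow_mul] at h2
  have h3 : ∑ k ∈ Finset.range (2 * n), (-1 : ℝ) ^ k *
        ((Real.pi - (s + 2 * k * δ)) / 2 * Real.cos (s + 2 * k * δ - φ))
      = (Real.pi - s) / 2 * ∑ k ∈ Finset.range (2 * n), (-1 : ℝ) ^ k * Real.cos (s - φ + 2 * k * δ)
        - δ * ∑ k ∈ Finset.range (2 * n), (-1 : ℝ) ^ k * (k * Real.cos (s - φ + 2 * k * δ)) := by
    rw [Finset.mul_sum, Finset.mul_sum, ← Finset.sum_sub_distrib]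
    refine Finset.sum_congr rfl fun k _ => ?_
    rw [show s + 2 * k * δ - φ = s - φ + 2 * k * δ by ring]
    ring
  have e2 : s - δ - φ = s - φ - δ := by ring
  rw [h3, h1, eq_div_iff (by positivity), e2]
  have e3 : 2 * (n : ℝ) * δ = Real.pi := by rw [hδ]; field_simp
  push_cast at h2
  linear_combination (-δ) * h2 + Real.cos (s - φ - δ) * e3

/-! ### Folding `L¹` norms over a period. -/

theorem integral_abs_eq_of_alternating {D : ℝ → ℝ} (hD : Continuous D) (h : ℝ) (N : ℕ)
    (h0 : 0 ≤ h)
    (hsign : ∀ᵐ s, s ∈ Ioo 0 h → (∀ k < N, 0 ≤ (-1 : ℝ) ^ k * D (s + k * h)) ∨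
      (∀ k < N, (-1 : ℝ) ^ k * D (s + k * h) ≤ 0)) :
    ∫ s in (0 : ℝ)..N * h, |D s|
      = ∫ s in (0 : ℝ)..h, |∑ k ∈ Finset.range N, (-1 : ℝ) ^ k * D (s + k * h)| := by
  have h1 := intervalIntegral.sum_integral_adjacent_intervals (μ := volume) (f := fun s => |D s|)
    (a := fun k : ℕ => (k : ℝ) * h) (n := N) (fun k _ => hD.abs.intervalIntegrable _ _)
  simp only [Nat.cast_zero, zero_mul] at h1
  rw [← h1]
  have h2 : ∀ k : ℕ, ∫ s in (k : ℝ) * h..(k + 1 : ℕ) * h, |D s|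
      = ∫ s in (0 : ℝ)..h, |D (s + k * h)| := by
    intro k
    rw [intervalIntegral.integral_comp_add_right (fun s => |D s|)]
    congr 1 <;> push_cast <;> ring
  simp only [h2]
  rw [← intervalIntegral.integral_finsetSum (fun k _ => Continuous.intervalIntegrable
    (by fun_prop) _ _)]
  rw [intervalIntegral.integral_of_le h0, intervalIntegral.integral_of_le h0,
    integral_Ioc_eq_integral_Ioo, integral_Ioc_eq_integral_Ioo]
  refine setIntegral_congr_ae measurableSet_Ioo ?_
  filter_upwards [hsign] with s hsign hs
  have habs : ∀ k : ℕ, |D (s + k * h)| = |(-1 : ℝ) ^ k * D (s + k * h)| := by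
    intro k; rw [abs_mul]; simp
  simp only [habs]
  rcases hsign hs with hp | hp
  · rw [abs_of_nonneg (Finset.sum_nonneg fun k hk => hp k (Finset.mem_range.1 hk))]
    exact Finset.sum_congr rfl fun k hk => abs_of_nonneg (hp k (Finset.mem_range.1 hk))
  · rw [abs_of_nonpos (Finset.sum_nonpos fun k hk => hp k (Finset.mem_range.1 hk)),
      ← Finset.sum_neg_distrib]
    exact Finset.sum_congr rfl fun k hk => abs_of_nonpos (hp k (Finset.mem_range.1 hk))

/-- The function `σ` records the sign pattern of the error: it flips under each shift by `π/n`, so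
the shifted errors alternate and their absolute values add up to the absolute value of the
alternating sum. That sum does not see `T`. -/
theorem integral_abs_sawtooth_sub {n : ℕ} (hn : 2 ≤ n) (φ : ℝ) {T : ℝ → ℝ} (hT : Continuous T)
    (hT0 : ∀ s, ∑ k ∈ Finset.range (2 * n),
      (-1 : ℝ) ^ k * T (s + 2 * k * (Real.pi / (2 * n))) = 0)
    {σ : ℝ → ℝ} (hσ : ∀ᵐ s, s ∈ Ioo 0 (Real.pi / n) → σ s ≠ 0)
    (hσ' : ∀ s (k : ℕ), σ (s + 2 * k * (Real.pi / (2 * n))) = (-1) ^ k * σ s)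
    (hsign : ∀ s ∈ Ioo 0 (2 * Real.pi),
      0 ≤ ((Real.pi - s) / 2 * Real.cos (s - φ) - T s) * σ s) :
    ∫ s in (0 : ℝ)..2 * Real.pi, |(Real.pi - s) / 2 * Real.cos (s - φ) - T s|
      = Real.pi / (2 * Real.cos (Real.pi / (2 * n))) *
        ∫ s in (0 : ℝ)..Real.pi / n, |Real.cos (s - Real.pi / (2 * n) - φ)| := by
  have hn0 : (2 : ℝ) ≤ n := by exact_mod_cast hn
  have hh : ∀ k : ℕ, 2 * (k : ℝ) * (Real.pi / (2 * n)) = k * (Real.pi / n) := by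
    intro k; field_simp
  have hc : 0 < Real.cos (Real.pi / (2 * n)) := by
    refine Real.cos_pos_of_mem_Ioo ⟨?_, ?_⟩
    · have : 0 < Real.pi / (2 * n) := by have := Real.pi_pos; positivity
      linarith [Real.pi_pos]
    · rw [div_lt_div_iff₀ (by positivity) (by positivity)]
      nlinarith [Real.pi_pos]
  have hπn : 0 < Real.pi / n := by have := Real.pi_pos; positivity
  set D : ℝ → ℝ := fun s => (Real.pi - s) / 2 * Real.cos (s - φ) - T s with hDdef
  have hD : Continuous D := by fun_prop
  have hper : ((2 * n : ℕ) : ℝ) * (Real.pi / n) = 2 * Real.pi := by push_cast; field_simp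
  have key := integral_abs_eq_of_alternating hD (Real.pi / n) (2 * n) hπn.le ?_
  · rw [hper] at key
    rw [key, ← intervalIntegral.integral_const_mul]
    refine intervalIntegral.integral_congr fun s _ => ?_
    have h1 := alternating_sum_sawtooth hn s φ
    have h2 := hT0 s
    simp only [hh] at h1 h2
    have h3 : ∑ k ∈ Finset.range (2 * n), (-1 : ℝ) ^ k * D (s + k * (Real.pi / n))
        = Real.pi * Real.cos (s - Real.pi / (2 * n) - φ) / (2 * Real.cos (Real.pi / (2 * n))) := by
      rw [← h1, ← sub_zero (∑ k ∈ _, _ * (_ / 2 * _)), ← h2, ← Finset.sum_sub_distrib]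
      exact Finset.sum_congr rfl fun k _ => by rw [hDdef]; ring
    simp only [h3]
    rw [abs_div, abs_mul, abs_of_pos Real.pi_pos, abs_of_pos (by positivity :
      0 < 2 * Real.cos (Real.pi / (2 * n)))]
    ring
  · filter_upwards [hσ] with s hσ hs
    have hk : ∀ k < 2 * n, 0 ≤ (-1 : ℝ) ^ k * D (s + k * (Real.pi / n)) * σ s := by
      intro k hk
      have hk1 : (k : ℝ) + 1 ≤ ((2 * n : ℕ) : ℝ) := by exact_mod_cast hk
      have hmem : s + k * (Real.pi / n) ∈ Ioo 0 (2 * Real.pi) := by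
        constructor
        · have := hs.1; positivity
        · rw [← hper]
          nlinarith [hs.2, mul_le_mul_of_nonneg_right hk1 hπn.le]
      have h := hsign _ hmem
      have h' := hσ' s k
      rw [hh] at h'
      rw [h'] at h
      calc _ ≤ _ := h
        _ = _ := by rw [hDdef]; ring
    rcases lt_or_gt_of_ne (hσ hs) with h | h
    · exact Or.inr fun k hk' => nonpos_of_mul_nonneg_left (hk k hk') h
    · exact Or.inl fun k hk' => nonneg_of_mul_nonneg_left (hk k hk') h

/-! ### `L¹` approximation of the two kernels. -/

open Polynomial in
theorem eq_leadingCoeff_mul_nodal {p : ℝ[X]} {S : Finset ℝ} (h : p.roots = S.val)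
    (hc : S.card = p.natDegree) : p = C p.leadingCoeff * Lagrange.nodal S id := by
  have := C_leadingCoeff_mul_prod_multiset_X_sub_C (p := p) (by rw [h]; exact hc)
  rw [h] at this
  exact this.symm

/-- Used because the Poisson formula controls the sign only on `(0, π)`; continuity supplies the
point `π`. -/
theorem nonneg_of_reflection {g : ℝ → ℝ} (hg : Continuous g) (hr : ∀ s, g (2 * Real.pi - s) = g s)
    (h : ∀ s ∈ Ioo 0 Real.pi, 0 ≤ g s) : ∀ s ∈ Ioo 0 (2 * Real.pi), 0 ≤ g s := by
  have hcl : ∀ s ∈ Icc 0 Real.pi, 0 ≤ g s := by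
    rw [← closure_Ioo Real.pi_pos.ne]
    exact closure_minimal h (isClosed_le continuous_const hg)
  intro s hs
  rcases le_total s Real.pi with h1 | h1
  · exact hcl s ⟨hs.1.le, h1⟩
  · rw [← hr]
    exact hcl _ ⟨by linarith [hs.2], by linarith⟩

theorem pi_div_two_mul_mem {n : ℕ} (hn : 2 ≤ n) : Real.pi / (2 * n) ∈ Ioo 0 (Real.pi / 2) := by
  have hn0 : (2 : ℝ) ≤ n := by exact_mod_cast hn
  refine ⟨by have := Real.pi_pos; positivity, ?_⟩
  rw [div_lt_div_iff₀ (by positivity) (by positivity)]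
  nlinarith [Real.pi_pos]

theorem integral_abs_cos_sub {δ : ℝ} (hδ : δ ∈ Ioo 0 (Real.pi / 2)) :
    ∫ s in (0 : ℝ)..2 * δ, |Real.cos (s - δ)| = 2 * Real.sin δ := by
  rw [intervalIntegral.integral_comp_sub_right (fun s => |Real.cos s|)]
  have : ∫ s in (0 - δ)..(2 * δ - δ), |Real.cos s| = ∫ s in (0 - δ)..(2 * δ - δ), Real.cos s := by
    refine intervalIntegral.integral_congr fun s hs => ?_
    rw [uIcc_of_le (by linarith [hδ.1])] at hs
    exact abs_of_nonneg (Real.cos_nonneg_of_mem_Icc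
      ⟨by linarith [hs.1, hδ.2], by linarith [hs.2, hδ.2]⟩)
  rw [this, integral_cos, show 2 * δ - δ = δ by ring, zero_sub, Real.sin_neg]
  ring

theorem integral_abs_sin_sub {δ : ℝ} (hδ : δ ∈ Ioo 0 (Real.pi / 2)) :
    ∫ s in (0 : ℝ)..2 * δ, |Real.sin (s - δ)| = 2 * (1 - Real.cos δ) := by
  rw [intervalIntegral.integral_comp_sub_right (fun s => |Real.sin s|)]
  have hi : ∀ a b, IntervalIntegrable (fun s => |Real.sin s|) volume a b := fun a b =>
    Continuous.intervalIntegrable (by fun_prop) _ _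
  have h1 : ∫ s in (0 - δ)..0, |Real.sin s| = ∫ s in (0 - δ)..0, -Real.sin s := by
    refine intervalIntegral.integral_congr fun s hs => ?_
    rw [uIcc_of_le (by linarith [hδ.1])] at hs
    exact abs_of_nonpos (Real.sin_nonpos_of_nonpos_of_neg_pi_le hs.2
      (by linarith [hs.1, hδ.2, Real.pi_pos]))
  have h2 : ∫ s in (0 : ℝ)..(2 * δ - δ), |Real.sin s| = ∫ s in (0 : ℝ)..(2 * δ - δ), Real.sin s := by
    refine intervalIntegral.integral_congr fun s hs => ?_
    rw [uIcc_of_le (by linarith [hδ.1])] at hs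
    exact abs_of_nonneg (Real.sin_nonneg_of_nonneg_of_le_pi hs.1
      (by linarith [hs.2, hδ.2, Real.pi_pos]))
  rw [← intervalIntegral.integral_add_adjacent_intervals (hi _ 0) (hi 0 _), h1, h2,
    intervalIntegral.integral_neg, integral_sin, integral_sin, show 2 * δ - δ = δ by ring, zero_sub,
    Real.cos_neg, Real.cos_zero]
  ring

/-- Best `L¹` approximation of `s ↦ (π - s) / 2 * cos s` by sine polynomials. -/
theorem exists_sine_polynomial {n : ℕ} (hn : 2 ≤ n) :
    ∃ v : ℕ → ℝ, ∫ s in (0 : ℝ)..2 * Real.pi, |(Real.pi - s) / 2 * Real.cos s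
      - ∑ m ∈ Finset.range (n - 1), v m * Real.sin ((m + 1) * s)|
        = Real.pi * Real.tan (Real.pi / (2 * n)) := by
  have hn0 : (2 : ℝ) ≤ n := by exact_mod_cast hn
  have hδ := pi_div_two_mul_mem hn
  have hnpos : (0 : ℝ) < n := by linarith
  obtain ⟨S, hS⟩ : ∃ S : Finset ℝ, S = (Finset.range (n - 1)).image
    (fun k : ℕ => Real.cos ((k + 1) * Real.pi / ((n - 1 : ℕ) + 1))) := ⟨_, rfl⟩
  have hroots : (Polynomial.Chebyshev.U ℝ (n - 1 : ℕ)).roots = S.val := by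
    rw [hS]; exact Polynomial.Chebyshev.roots_U_real (n - 1)
  have hcard : S.card = n - 1 := by
    rw [hS, Finset.card_image_of_injOn, Finset.card_range]
    exact (Finset.range _).nodup_map_iff_injOn.mp (Polynomial.Chebyshev.roots_U_real_nodup _)
  have hcast : ((n - 1 : ℕ) : ℝ) + 1 = n := by
    rw [Nat.cast_sub (by omega)]; simp
  have hSmem : ∀ y ∈ S, y ∈ Ioo (-1 : ℝ) 1 := by
    intro y hy
    rw [hS, Finset.mem_image] at hy
    obtain ⟨k, hk, rfl⟩ := hy
    have hk' : (k : ℝ) + 1 < n := by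
      have := Finset.mem_range.1 hk
      exact_mod_cast (by omega : k + 1 < n)
    rw [hcast]
    refine cos_mem_Ioo ⟨by have := Real.pi_pos; positivity, ?_⟩
    rw [div_lt_iff₀ hnpos]
    nlinarith [Real.pi_pos]
  have hU := eq_leadingCoeff_mul_nodal hroots
    (by rw [hcard, Polynomial.Chebyshev.natDegree_U_natCast])
  rw [Polynomial.Chebyshev.leadingCoeff_U_natCast] at hU
  have hsin : ∀ s, Real.sin (n * s)
      = 2 ^ (n - 1) * (Lagrange.nodal S id).eval (Real.cos s) * Real.sin s := by
    intro s
    have := Polynomial.Chebyshev.U_real_cos s (n - 1 : ℕ)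
    rw [hU] at this
    simp only [Polynomial.eval_mul, Polynomial.eval_C] at this
    rw [this]
    congr 1
    push_cast
    rw [hcast]
  obtain ⟨v, hv⟩ := exists_eq_sum_of_natDegree_eq
    (p := fun k : ℕ => Polynomial.Chebyshev.U ℝ k)
    (fun k => Polynomial.Chebyshev.degree_U_natCast _ k) (n - 1)
    (Lagrange.interpolate S id (fun y => Polynomial.X.eval y * poissonIntegral y))
    (by rw [← hcard]; exact Lagrange.degree_interpolate_lt _ Function.injective_id.injOn)
  have hT : ∀ s, Real.sin s * (Lagrange.interpolate S id
      (fun y => Polynomial.X.eval y * poissonIntegral y)).eval (Real.cos s)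
      = ∑ m ∈ Finset.range (n - 1), v m * Real.sin ((m + 1) * s) := by
    intro s
    rw [hv, Polynomial.eval_finsetSum, Finset.mul_sum]
    refine Finset.sum_congr rfl fun m _ => ?_
    have := Polynomial.Chebyshev.U_real_cos s m
    simp only [Polynomial.eval_mul, Polynomial.eval_C]
    push_cast at this
    rw [← this]; ring
  refine ⟨v, ?_⟩
  have key := integral_abs_sawtooth_sub hn 0
    (T := fun s => ∑ m ∈ Finset.range (n - 1), v m * Real.sin ((m + 1) * s)) (by fun_prop) ?_
    (σ := fun s => Real.sin (n * s)) ?_ ?_ ?_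
  · simp only [sub_zero] at key
    rw [key, show Real.pi / n = 2 * (Real.pi / (2 * n)) by field_simp, integral_abs_cos_sub hδ,
      Real.tan_eq_sin_div_cos]
    have := (Real.cos_pos_of_mem_Ioo ⟨by linarith [hδ.1, Real.pi_pos], hδ.2⟩).ne'
    field_simp
  · intro s
    simp only [Finset.mul_sum]
    rw [Finset.sum_comm]
    refine Finset.sum_eq_zero fun m hm => ?_
    have hm' := Finset.mem_range.1 hm
    have := alternating_sum_cos_eq_zero (n := n) (m := m + 1) (by omega)
      ((m + 1) * s - Real.pi / 2)
    rw [← mul_zero (v m), ← this, Finset.mul_sum]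
    refine Finset.sum_congr rfl fun k _ => ?_
    rw [← Real.cos_sub_pi_div_two]
    push_cast
    rw [show (m + 1) * s - Real.pi / 2 + 2 * k * ((m + 1) * (Real.pi / (2 * n)))
      = (m + 1) * (s + 2 * k * (Real.pi / (2 * n))) - Real.pi / 2 by ring]
    ring
  · refine Filter.Eventually.of_forall fun s hs => (Real.sin_pos_of_pos_of_lt_pi ?_ ?_).ne'
    · have := hs.1; positivity
    · have := hs.2; rw [lt_div_iff₀ hnpos] at this; linarith
  · intro s k
    rw [← Real.sin_add_nat_mul_pi]
    congr 1
    field_simp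
  · refine nonneg_of_reflection (by fun_prop) ?_ ?_
    · intro s
      have h1 : Real.sin (n * (2 * Real.pi - s)) = - Real.sin (n * s) := by
        rw [show n * (2 * Real.pi - s) = n * (2 * Real.pi) - n * s by ring,
          Real.sin_nat_mul_two_pi_sub]
      have h2 : ∀ m : ℕ, Real.sin ((m + 1) * (2 * Real.pi - s)) = - Real.sin ((m + 1) * s) := by
        intro m
        have := Real.sin_nat_mul_two_pi_sub ((m + 1) * s) (m + 1)
        rw [← this]; congr 1; push_cast; ring
      simp only [h1, h2, sub_zero, Real.cos_two_pi_sub, mul_neg, Finset.sum_neg_distrib]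
      ring
    · intro s hs
      -- The choice `w = X` comes from `(π - s) / 2 * cos s = sin s * (cos s * poissonIntegral (cos
      -- s))`; its degree `1` is at most `n - 1`.
      have h0 := interpolate_error_mul_nodal_nonneg S hSmem Polynomial.X
        (by rw [Polynomial.natDegree_X, hcard]; omega) (fun a ha => by simp; linarith)
        (cos_mem_Ioo hs)
      have hs0 := Real.sin_pos_of_mem_Ioo hs
      rw [← hT, hsin, sub_zero]
      rw [poissonIntegral_cos hs] at h0
      have : ((Real.pi - s) / 2 * Real.cos s - Real.sin s * (Lagrange.interpolate S id
          (fun y => Polynomial.X.eval y * poissonIntegral y)).eval (Real.cos s))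
          * (2 ^ (n - 1) * (Lagrange.nodal S id).eval (Real.cos s) * Real.sin s)
          = 2 ^ (n - 1) * Real.sin s ^ 2 *
          ((Polynomial.X.eval (Real.cos s) * ((Real.pi - s) / (2 * Real.sin s))
      - (Lagrange.interpolate S id (fun y => Polynomial.X.eval y * poissonIntegral y)).eval
        (Real.cos s)) * (Lagrange.nodal S id).eval (Real.cos s)) := by
        rw [Polynomial.eval_X]
        field_simp
      rw [this]
      positivity

/-- Best `L¹` approximation of `s ↦ (π - s) / 2 * sin s` by cosine polynomials. -/
theorem exists_cosine_polynomial {n : ℕ} (hn : 2 ≤ n) :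
    ∃ v : ℕ → ℝ, ∫ s in (0 : ℝ)..2 * Real.pi, |(Real.pi - s) / 2 * Real.sin s
      - ∑ m ∈ Finset.range n, v m * Real.cos (m * s)|
        = Real.pi * (1 / Real.cos (Real.pi / (2 * n)) - 1) := by
  have hn0 : (2 : ℝ) ≤ n := by exact_mod_cast hn
  have hδ := pi_div_two_mul_mem hn
  have hnpos : (0 : ℝ) < n := by linarith
  obtain ⟨S, hS⟩ : ∃ S : Finset ℝ, S = (Finset.range n).image
    (fun k : ℕ => Real.cos ((2 * k + 1) * Real.pi / (2 * n))) := ⟨_, rfl⟩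
  have hroots : (Polynomial.Chebyshev.T ℝ n).roots = S.val := by
    rw [hS]; exact Polynomial.Chebyshev.roots_T_real n
  have hcard : S.card = n := by
    rw [hS, Finset.card_image_of_injOn, Finset.card_range]
    exact (Finset.range _).nodup_map_iff_injOn.mp (Polynomial.Chebyshev.roots_T_real_nodup _)
  have hSmem : ∀ y ∈ S, y ∈ Ioo (-1 : ℝ) 1 := by
    intro y hy
    rw [hS, Finset.mem_image] at hy
    obtain ⟨k, hk, rfl⟩ := hy
    have hk' : (k : ℝ) + 1 ≤ n := by exact_mod_cast Finset.mem_range.1 hk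
    refine cos_mem_Ioo ⟨by have := Real.pi_pos; positivity, ?_⟩
    rw [div_lt_iff₀ (by positivity)]
    nlinarith [Real.pi_pos]
  have hU := eq_leadingCoeff_mul_nodal hroots
    (by rw [hcard, Polynomial.Chebyshev.natDegree_T]; simp)
  rw [Polynomial.Chebyshev.leadingCoeff_T] at hU
  obtain ⟨c, hc0, hc⟩ : ∃ c : ℝ, 0 < c ∧ Polynomial.Chebyshev.T ℝ n
      = Polynomial.C c * Lagrange.nodal S id := ⟨_, by positivity, hU⟩
  have hcos : ∀ s, Real.cos (n * s) = c * (Lagrange.nodal S id).eval (Real.cos s) := by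
    intro s
    have := Polynomial.Chebyshev.T_real_cos s n
    rw [hc] at this
    simp only [Polynomial.eval_mul, Polynomial.eval_C] at this
    rw [this]
    push_cast
    rfl
  -- The kernel is `sin² s * poissonIntegral (cos s)`, but `1 - X²` is negative beyond `1`. Its
  -- negative is interpolated instead, which accounts for `-I` and for the sign in `σ = -cos (n s)`.
  set w : Polynomial ℝ := Polynomial.X ^ 2 - 1 with hw
  set I := Lagrange.interpolate S id (fun y => w.eval y * poissonIntegral y) with hI
  obtain ⟨v, hv⟩ := exists_eq_sum_of_natDegree_eq
    (p := fun k : ℕ => Polynomial.Chebyshev.T ℝ k)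
    (fun k => by rw [Polynomial.Chebyshev.degree_T]; simp) n (-I)
    (by rw [Polynomial.degree_neg]
        exact (Lagrange.degree_interpolate_lt _ Function.injective_id.injOn).trans_eq
          (by rw [hcard]))
  have hT : ∀ s, - I.eval (Real.cos s) = ∑ m ∈ Finset.range n, v m * Real.cos (m * s) := by
    intro s
    rw [← Polynomial.eval_neg, hv, Polynomial.eval_finsetSum]
    refine Finset.sum_congr rfl fun m _ => ?_
    have := Polynomial.Chebyshev.T_real_cos s m
    simp only [Polynomial.eval_mul, Polynomial.eval_C]
    rw [this]
    push_cast
    rfl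
  refine ⟨v, ?_⟩
  have key := integral_abs_sawtooth_sub hn (Real.pi / 2)
    (T := fun s => ∑ m ∈ Finset.range n, v m * Real.cos (m * s)) (by fun_prop) ?_
    (σ := fun s => - Real.cos (n * s)) ?_ ?_ ?_
  · simp only [Real.cos_sub_pi_div_two] at key
    rw [key, show Real.pi / n = 2 * (Real.pi / (2 * n)) by field_simp, integral_abs_sin_sub hδ]
    have := (Real.cos_pos_of_mem_Ioo ⟨by linarith [hδ.1, Real.pi_pos], hδ.2⟩).ne'
    field_simp
  · intro s
    simp only [Finset.mul_sum]
    rw [Finset.sum_comm]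
    refine Finset.sum_eq_zero fun m hm => ?_
    have hm' := Finset.mem_range.1 hm
    have := alternating_sum_cos_eq_zero hm' (m * s)
    rw [← mul_zero (v m), ← this, Finset.mul_sum]
    refine Finset.sum_congr rfl fun k _ => ?_
    rw [show m * s + 2 * k * (m * (Real.pi / (2 * n)))
      = m * (s + 2 * k * (Real.pi / (2 * n))) by ring]
    ring
  -- Here `σ` vanishes at the midpoint of `(0, π/n)`, so it is nonzero only almost everywhere.
  · filter_upwards [(Set.countable_singleton (Real.pi / (2 * n))).ae_notMem volume] with s hs0 hs
    rw [neg_ne_zero]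
    intro h
    have h1 : (n : ℝ) * s ∈ Icc 0 Real.pi := by
      have h2 := hs.2; rw [lt_div_iff₀ hnpos] at h2
      exact ⟨by have := hs.1; positivity, by linarith⟩
    have h2 : Real.pi / 2 ∈ Icc 0 Real.pi := ⟨by linarith [Real.pi_pos], by linarith [Real.pi_pos]⟩
    have h3 := Real.injOn_cos h1 h2 (by rw [h, Real.cos_pi_div_two])
    apply hs0
    rw [mem_singleton_iff]
    field_simp
    linarith
  · intro s k
    rw [mul_neg, ← Real.cos_add_nat_mul_pi]
    congr 2
    field_simp
  · refine nonneg_of_reflection (by fun_prop) ?_ ?_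
    · intro s
      have h2 : ∀ m : ℕ, Real.cos (m * (2 * Real.pi - s)) = Real.cos (m * s) := by
        intro m
        rw [mul_sub, Real.cos_nat_mul_two_pi_sub]
      simp only [h2, Real.cos_sub_pi_div_two, Real.sin_two_pi_sub]
      ring
    · intro s hs
      have h0 := interpolate_error_mul_nodal_nonneg S hSmem w
        (by rw [hcard]
            refine (Polynomial.natDegree_sub_le _ _).trans ?_
            simpa using hn) (fun a ha => by
          simp only [hw, Polynomial.eval_sub, Polynomial.eval_pow, Polynomial.eval_X,
            Polynomial.eval_one]
          nlinarith)
        (cos_mem_Ioo hs)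
      have hs0 := Real.sin_pos_of_mem_Ioo hs
      rw [← hT, hcos, Real.cos_sub_pi_div_two]
      rw [poissonIntegral_cos hs, ← hI] at h0
      have hwe : w.eval (Real.cos s) = - Real.sin s ^ 2 := by
        simp [hw]; linarith [Real.sin_sq_add_cos_sq s]
      rw [hwe] at h0
      have : ((Real.pi - s) / 2 * Real.sin s - -I.eval (Real.cos s))
          * -(c * (Lagrange.nodal S id).eval (Real.cos s))
          = c * ((- Real.sin s ^ 2 * ((Real.pi - s) / (2 * Real.sin s))
            - I.eval (Real.cos s)) * (Lagrange.nodal S id).eval (Real.cos s)) := by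
        field_simp
        ring
      rw [this]
      positivity

/-! ### The sawtooth and the integral representation of `f`. -/

/-- The odd `2 * π`-periodic function which equals `(π - s) / 2` on `(0, 2 * π)`. -/
noncomputable def sawtooth (s : ℝ) : ℝ := Real.arctan (Real.tan (s / 2))⁻¹

theorem sawtooth_of_mem {s : ℝ} (hs : s ∈ Ioo 0 (2 * Real.pi)) :
    sawtooth s = (Real.pi - s) / 2 := by
  rw [sawtooth, ← Real.tan_pi_div_two_sub, Real.arctan_tan]
  · ring
  · linarith [hs.2]
  · linarith [hs.1]

theorem sawtooth_neg (s : ℝ) : sawtooth (-s) = -sawtooth s := by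
  rw [sawtooth, sawtooth, neg_div, Real.tan_neg, inv_neg, Real.arctan_neg]

theorem sawtooth_periodic : Function.Periodic sawtooth (2 * Real.pi) := by
  intro s
  rw [sawtooth, sawtooth, show (s + 2 * Real.pi) / 2 = s / 2 + Real.pi by ring,
    Real.tan_periodic]

theorem measurable_sawtooth : Measurable sawtooth := by
  have : Measurable Real.tan := by
    simp only [funext Real.tan_eq_sin_div_cos]
    exact Real.measurable_sin.div Real.measurable_cos
  exact Real.measurable_arctan.comp (this.comp (measurable_id.div_const 2)).inv

theorem abs_sawtooth_le (s : ℝ) : |sawtooth s| ≤ Real.pi / 2 :=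
  abs_le.2 ⟨(Real.neg_pi_div_two_lt_arctan _).le, (Real.arctan_lt_pi_div_two _).le⟩

section FTC
variable {𝕜 : Type*} [RCLike 𝕜]

/-- The difference of `f` and the Lipschitz primitive of `F` is absolutely continuous with
derivative zero almost everywhere, hence constant. -/
theorem AbsolutelyContinuousOnInterval.integral_eq_sub_of_bounded {f F : ℝ → 𝕜}
    {a b : ℝ} (hf : AbsolutelyContinuousOnInterval f a b) (hF : Measurable F)
    (hF1 : ∀ u, ‖F u‖ ≤ 1) (hfF : ∀ᵐ u, u ∈ uIcc a b → deriv f u = F u)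
    {x : ℝ} (hx : x ∈ uIcc a b) : ∫ u in a..x, F u = f x - f a := by
  have hi : ∀ c d, IntervalIntegrable F volume c d := fun c d => by
    rw [intervalIntegrable_iff]
    exact Measure.integrableOn_of_bounded (by simp [uIoc]) hF.aestronglyMeasurable
      (Filter.Eventually.of_forall hF1)
  have hlip : LipschitzWith 1 fun x => ∫ t in a..x, F t := by
    refine LipschitzWith.of_dist_le_mul fun c d => ?_
    rw [dist_eq_norm, intervalIntegral.integral_interval_sub_left (hi _ _) (hi _ _), dist_comm,
      Real.dist_eq, abs_sub_comm]
    exact (intervalIntegral.norm_integral_le_of_norm_le_const fun u _ => hF1 u).trans_eq (by simp)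
  have hac := hlip.lipschitzOnWith (s := uIcc a b) |>.absolutelyContinuousOnInterval
  have hg : ∀ᵐ x, x ∈ uIcc a b → HasDerivAt (f - fun x => ∫ t in a..x, F t) 0 x := by
    filter_upwards [hf.boundedVariationOn.ae_differentiableAt_of_mem_uIcc,
      (hi a b).ae_hasDerivAt_integral, hfF] with x hx₁ hx₂ hfx hx₃
    have := (hx₁ hx₃).hasDerivAt.sub (hx₂ hx₃ a (by simp))
    rwa [hfx hx₃, sub_self] at this
  obtain ⟨C, hC⟩ := (hf.sub hac).const_of_ae_hasDerivAt_zero hg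
  have h1 := hC x hx
  have h2 := hC a (by simp)
  simp only [Pi.sub_apply, intervalIntegral.integral_same, sub_zero] at h1 h2
  rw [← h2] at h1
  rw [← h1]
  abel

theorem MemW1.exists_integral_eq {f : ℝ → 𝕜} (hf : MemW1 f) (hf1 : w1Norm f ≤ 1) :
    ∃ F : ℝ → 𝕜, Measurable F ∧ (∀ u, ‖F u‖ ≤ 1) ∧
      ∀ x ∈ Icc (-1 : ℝ) 1, f x = f (-1) + ∫ u in (-1 : ℝ)..x, F u := by
  have hm : Measurable (deriv f) := measurable_deriv f
  have hae : ∀ᵐ u ∂(volume.restrict (Icc (-1 : ℝ) 1)), ‖deriv f u‖ ≤ 1 := by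
    rw [w1Norm, eLpNorm_exponent_top] at hf1
    filter_upwards [ae_le_eLpNormEssSup (f := deriv f)
      (μ := volume.restrict (Icc (-1 : ℝ) 1))] with u hu
    have := hu.trans hf1
    rw [← ofReal_norm, ENNReal.ofReal_le_one] at this
    exact this
  have hms : MeasurableSet {u | ‖deriv f u‖ ≤ 1} := measurableSet_le hm.norm measurable_const
  -- Setting the derivative to zero on the exceptional null set makes the bound hold everywhere, so
  -- it survives composition with `cos`.
  have hF1 : ∀ u, ‖{u | ‖deriv f u‖ ≤ 1}.indicator (deriv f) u‖ ≤ 1 := fun u => by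
    by_cases h : ‖deriv f u‖ ≤ 1
    · rwa [indicator_of_mem (show u ∈ {u | ‖deriv f u‖ ≤ 1} from h)]
    · rw [indicator_of_notMem (show u ∉ {u | ‖deriv f u‖ ≤ 1} from h)]; simp
  refine ⟨_, hm.indicator hms, hF1, fun x hx => ?_⟩
  have hu : uIcc (-1 : ℝ) 1 = Icc (-1) 1 := uIcc_of_le (by norm_num)
  rw [hf.1.integral_eq_sub_of_bounded (hm.indicator hms) hF1 ?_ (by rwa [hu])]
  · abel
  · rw [ae_restrict_iff' measurableSet_Icc] at hae
    filter_upwards [hae] with u hae huI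
    rw [hu] at huI
    exact (indicator_of_mem (show u ∈ {u | ‖deriv f u‖ ≤ 1} from hae huI) _).symm

theorem integral_sin_smul_comp_cos (F : ℝ → 𝕜) {t : ℝ} (ht : t ∈ Icc 0 Real.pi) :
    ∫ τ in t..Real.pi, Real.sin τ • F (Real.cos τ) = ∫ u in (-1 : ℝ)..Real.cos t, F u := by
  have hinj : InjOn Real.cos (Icc t Real.pi) :=
    Real.injOn_cos.mono (Icc_subset_Icc_left ht.1)
  have himg : Real.cos '' Icc t Real.pi = Icc (-1) (Real.cos t) := by
    apply Subset.antisymm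
    · rintro _ ⟨τ, hτ, rfl⟩
      exact ⟨Real.neg_one_le_cos τ, Real.cos_le_cos_of_nonneg_of_le_pi ht.1 hτ.2 hτ.1⟩
    · have := intermediate_value_Icc' ht.2 Real.continuous_cos.continuousOn
      rwa [Real.cos_pi] at this
  have h := integral_image_eq_integral_abs_deriv_smul (s := Icc t Real.pi) (f := Real.cos)
    (f' := fun τ => -Real.sin τ) measurableSet_Icc
    (fun τ _ => (Real.hasDerivAt_cos τ).hasDerivWithinAt) hinj F
  rw [himg] at h
  rw [intervalIntegral.integral_of_le ht.2,
    intervalIntegral.integral_of_le (Real.neg_one_le_cos t), ← integral_Icc_eq_integral_Ioc,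
    ← integral_Icc_eq_integral_Ioc, h]
  refine setIntegral_congr_fun measurableSet_Icc fun τ hτ => ?_
  rw [abs_neg, abs_of_nonneg (Real.sin_nonneg_of_nonneg_of_le_pi (ht.1.trans hτ.1) hτ.2)]

theorem intervalIntegrable_smul_of_bounded {G : ℝ → 𝕜} (hG : Measurable G)
    (hG1 : ∀ u, ‖G u‖ ≤ 1) {φ : ℝ → ℝ} (hφ : Measurable φ) {C : ℝ} (hC : ∀ u, |φ u| ≤ C) (a b : ℝ) :
    IntervalIntegrable (fun u => φ u • G u) volume a b := by
  rw [intervalIntegrable_iff]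
  refine Measure.integrableOn_of_bounded (M := C) (by simp [uIoc])
    (hφ.smul hG).aestronglyMeasurable (Filter.Eventually.of_forall fun u => ?_)
  rw [norm_smul, Real.norm_eq_abs]
  calc |φ u| * ‖G u‖ ≤ |φ u| * 1 := by gcongr; exact hG1 u
    _ ≤ C := by rw [mul_one]; exact hC u

theorem integral_symm_eq {g : ℝ → 𝕜} (hg : ∀ a b, IntervalIntegrable g volume a b) (c : ℝ) :
    ∫ τ in -c..c, g τ = ∫ τ in (0 : ℝ)..c, (g τ + g (-τ)) := by
  have hg' : IntervalIntegrable (fun τ => g (-τ)) volume 0 c := by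
    have := (hg 0 (-c)).comp_mul_left (c := -1)
    simpa using this
  rw [← intervalIntegral.integral_add_adjacent_intervals (hg (-c) 0) (hg 0 c),
    intervalIntegral.integral_add (hg 0 c) hg', intervalIntegral.integral_comp_neg]
  simp [add_comm]

/-- Folding `τ` with `-τ` leaves the kernel `sawtooth (t - τ) - sawtooth (t + τ)`, which is `τ` for
`τ < t` and `τ - π` for `τ > t`. The jump produces the primitive of `F`; the rest is independent of
`t`. -/
theorem integral_sawtooth_smul {F : ℝ → 𝕜} (hF : Measurable F) (hF1 : ∀ u, ‖F u‖ ≤ 1) {t : ℝ}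
    (ht : t ∈ Icc 0 Real.pi) :
    ∫ τ in -Real.pi..Real.pi, (sawtooth (t - τ) * Real.sin τ) • F (Real.cos τ)
      = (∫ τ in (0 : ℝ)..Real.pi, (τ * Real.sin τ) • F (Real.cos τ))
        - Real.pi • ∫ u in (-1 : ℝ)..Real.cos t, F u := by
  have hG : Measurable fun τ => F (Real.cos τ) := hF.comp Real.measurable_cos
  have hG1 : ∀ τ, ‖F (Real.cos τ)‖ ≤ 1 := fun τ => hF1 _
  have hbd : ∀ τ, |sawtooth (t - τ) * Real.sin τ| ≤ Real.pi / 2 := fun τ => by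
    rw [abs_mul]
    calc _ ≤ Real.pi / 2 * 1 := by
          gcongr
          · exact abs_sawtooth_le _
          · exact Real.abs_sin_le_one τ
      _ = _ := mul_one _
  have hmeas : Measurable fun τ => sawtooth (t - τ) * Real.sin τ :=
    (measurable_sawtooth.comp (measurable_const.sub measurable_id)).mul Real.measurable_sin
  have hsinint : ∀ a b, IntervalIntegrable (fun τ => Real.sin τ • F (Real.cos τ)) volume a b :=
    intervalIntegrable_smul_of_bounded hG hG1 Real.measurable_sin Real.abs_sin_le_one
  have hidint : ∀ a b, IntervalIntegrable (fun τ => (τ * Real.sin τ) • F (Real.cos τ)) volume a b :=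
    fun a b => by
      simpa only [smul_smul, id] using (hsinint a b).continuousOn_smul continuousOn_id
  rw [integral_symm_eq (intervalIntegrable_smul_of_bounded hG hG1 hmeas hbd),
    ← integral_sin_smul_comp_cos F ht, ← intervalIntegral.integral_smul]
  simp only [sub_neg_eq_add, Real.sin_neg, Real.cos_neg, ← add_smul]
  have hint : IntervalIntegrable
      (fun τ => (sawtooth (t - τ) * Real.sin τ + sawtooth (t + τ) * -Real.sin τ) • F (Real.cos τ))
      volume 0 Real.pi := by
    refine intervalIntegrable_smul_of_bounded hG hG1 ?_ (C := Real.pi / 2 + Real.pi / 2) ?_ 0 Real.pi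
    · exact hmeas.add ((measurable_sawtooth.comp (measurable_const.add measurable_id)).mul
        Real.measurable_sin.neg)
    · intro τ
      refine (abs_add_le _ _).trans (add_le_add (hbd τ) ?_)
      have := hbd (-τ)
      rwa [sub_neg_eq_add, Real.sin_neg] at this
  have hmem : t ∈ uIcc 0 Real.pi := by rwa [uIcc_of_le Real.pi_pos.le]
  rw [← intervalIntegral.integral_add_adjacent_intervals
      (hint.mono_set (uIcc_subset_uIcc_left hmem)) (hint.mono_set (uIcc_subset_uIcc_right hmem)),
    ← intervalIntegral.integral_add_adjacent_intervals (hidint 0 t) (hidint t Real.pi), add_sub_assoc,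
    ← intervalIntegral.integral_sub (hidint t Real.pi)
      (show IntervalIntegrable (fun τ => Real.pi • Real.sin τ • F (Real.cos τ)) volume t Real.pi from
        (hsinint t Real.pi).smul Real.pi)]
  congr 1
  · rw [intervalIntegral.integral_of_le ht.1, intervalIntegral.integral_of_le ht.1,
      integral_Ioc_eq_integral_Ioo, integral_Ioc_eq_integral_Ioo]
    refine setIntegral_congr_fun measurableSet_Ioo fun τ hτ => ?_
    rw [sawtooth_of_mem ⟨by linarith [hτ.2], by linarith [hτ.1, ht.2, Real.pi_pos]⟩,
      sawtooth_of_mem ⟨by linarith [hτ.1, hτ.2], by linarith [hτ.2, ht.2]⟩]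
    congr 1; ring
  · rw [intervalIntegral.integral_of_le ht.2, intervalIntegral.integral_of_le ht.2,
      integral_Ioc_eq_integral_Ioo, integral_Ioc_eq_integral_Ioo]
    refine setIntegral_congr_fun measurableSet_Ioo fun τ hτ => ?_
    rw [← neg_sub τ t, sawtooth_neg,
      sawtooth_of_mem (s := τ - t) ⟨by linarith [hτ.1], by linarith [hτ.2, ht.1, Real.pi_pos]⟩,
      sawtooth_of_mem ⟨by linarith [hτ.1, ht.1], by linarith [hτ.2, ht.2]⟩, smul_smul, ← sub_smul]
    congr 1; ring

/-- By the addition formula; the odd part integrates to zero against an even `G`. Thus convolution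
with a sine polynomial yields a sine polynomial again. -/
theorem integral_sin_smul_even {G : ℝ → 𝕜} (hG : Measurable G) (hG1 : ∀ u, ‖G u‖ ≤ 1)
    (he : ∀ u, G (-u) = G u) (k t : ℝ) :
    ∫ τ in -Real.pi..Real.pi, Real.sin (k * (t - τ)) • G τ
      = Real.sin (k * t) • ∫ τ in -Real.pi..Real.pi, Real.cos (k * τ) • G τ := by
  have h1 := intervalIntegrable_smul_of_bounded hG hG1 (φ := fun τ => Real.sin (k * τ))
    (by fun_prop) (fun u => Real.abs_sin_le_one _)
  have h2 := intervalIntegrable_smul_of_bounded hG hG1 (φ := fun τ => Real.cos (k * τ))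
    (by fun_prop) (fun u => Real.abs_cos_le_one _)
  have h1' : ∀ c : ℝ, IntervalIntegrable (fun τ => c • Real.sin (k * τ) • G τ) volume
    (-Real.pi) Real.pi := fun c => (h1 _ _).smul c
  have h2' : ∀ c : ℝ, IntervalIntegrable (fun τ => c • Real.cos (k * τ) • G τ) volume
    (-Real.pi) Real.pi := fun c => (h2 _ _).smul c
  have h0 : ∫ τ in -Real.pi..Real.pi, Real.sin (k * τ) • G τ = 0 := by
    rw [integral_symm_eq h1]
    simp [he]
  have e : ∀ τ, Real.sin (k * (t - τ)) • G τ
      = Real.sin (k * t) • (Real.cos (k * τ) • G τ) - Real.cos (k * t) • (Real.sin (k * τ) • G τ) := by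
    intro τ
    rw [mul_sub, Real.sin_sub, sub_smul, mul_smul, mul_smul]
  simp only [e]
  rw [intervalIntegral.integral_sub (h2' _) (h1' _),
    intervalIntegral.integral_smul, intervalIntegral.integral_smul, h0, smul_zero, sub_zero]

theorem integral_cos_smul_even {G : ℝ → 𝕜} (hG : Measurable G) (hG1 : ∀ u, ‖G u‖ ≤ 1)
    (he : ∀ u, G (-u) = G u) (k t : ℝ) :
    ∫ τ in -Real.pi..Real.pi, Real.cos (k * (t - τ)) • G τ
      = Real.cos (k * t) • ∫ τ in -Real.pi..Real.pi, Real.cos (k * τ) • G τ := by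
  have h1 := intervalIntegrable_smul_of_bounded hG hG1 (φ := fun τ => Real.sin (k * τ))
    (by fun_prop) (fun u => Real.abs_sin_le_one _)
  have h2 := intervalIntegrable_smul_of_bounded hG hG1 (φ := fun τ => Real.cos (k * τ))
    (by fun_prop) (fun u => Real.abs_cos_le_one _)
  have h1' : ∀ c : ℝ, IntervalIntegrable (fun τ => c • Real.sin (k * τ) • G τ) volume
    (-Real.pi) Real.pi := fun c => (h1 _ _).smul c
  have h2' : ∀ c : ℝ, IntervalIntegrable (fun τ => c • Real.cos (k * τ) • G τ) volume
    (-Real.pi) Real.pi := fun c => (h2 _ _).smul c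
  have h0 : ∫ τ in -Real.pi..Real.pi, Real.sin (k * τ) • G τ = 0 := by
    rw [integral_symm_eq h1]
    simp [he]
  have e : ∀ τ, Real.cos (k * (t - τ)) • G τ
      = Real.cos (k * t) • (Real.cos (k * τ) • G τ) + Real.sin (k * t) • (Real.sin (k * τ) • G τ) := by
    intro τ
    rw [mul_sub, Real.cos_sub, add_smul, mul_smul, mul_smul]
  simp only [e]
  rw [intervalIntegral.integral_add (h2' _) (h1' _),
    intervalIntegral.integral_smul, intervalIntegral.integral_smul, h0, smul_zero, add_zero]

theorem integral_comp_sub_left_of_periodic {g : ℝ → ℝ} (hg : Function.Periodic g (2 * Real.pi))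
    (t : ℝ) : ∫ τ in -Real.pi..Real.pi, g (t - τ) = ∫ s in (0 : ℝ)..2 * Real.pi, g s := by
  rw [intervalIntegral.integral_comp_sub_left]
  have := hg.intervalIntegral_add_eq (t - Real.pi) 0
  rw [zero_add] at this
  rw [← this]
  congr 1
  ring

theorem integral_abs_sawtooth_mul_sub (φ T : ℝ → ℝ)
    (hφ : Function.Periodic φ (2 * Real.pi)) (hT : Function.Periodic T (2 * Real.pi)) (t : ℝ) :
    ∫ τ in -Real.pi..Real.pi, |sawtooth (t - τ) * φ (t - τ) - T (t - τ)|
      = ∫ s in (0 : ℝ)..2 * Real.pi, |(Real.pi - s) / 2 * φ s - T s| := by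
  rw [integral_comp_sub_left_of_periodic (g := fun s => |sawtooth s * φ s - T s|)]
  · have : (0 : ℝ) ≤ 2 * Real.pi := by linarith [Real.pi_pos]
    rw [intervalIntegral.integral_of_le this, intervalIntegral.integral_of_le this,
      integral_Ioc_eq_integral_Ioo, integral_Ioc_eq_integral_Ioo]
    exact setIntegral_congr_fun measurableSet_Ioo fun s hs => by rw [sawtooth_of_mem hs]
  · intro s
    simp only
    rw [sawtooth_periodic, hφ, hT]

end FTC

/-! ### Assembly of the approximating polynomial. -/

open Polynomial in
theorem theorem2 {𝕜 : Type*} [RCLike 𝕜] (f : ℝ → 𝕜) (hf : MemW1 f) (hf1 : w1Norm f ≤ 1)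
    (n : ℕ) (hn : 2 ≤ n) :
    ∃ P : Polynomial 𝕜, P.natDegree ≤ n ∧
      ∀ x ∈ Icc (-1 : ℝ) 1,
        ‖f x - P.eval (x : 𝕜)‖ ≤
          Real.tan (Real.pi / (2 * (n : ℝ))) * Real.sqrt (1 - x ^ 2)
            + (1 / Real.cos (Real.pi / (2 * (n : ℝ))) - 1) * Real.sqrt (x ^ 2) := by
  obtain ⟨F, hF, hF1, hfF⟩ := hf.exists_integral_eq hf1
  obtain ⟨v, hv⟩ := exists_sine_polynomial hn
  obtain ⟨v', hv'⟩ := exists_cosine_polynomial hn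
  have hpi := Real.pi_pos
  set G : ℝ → 𝕜 := fun τ => F (Real.cos τ) with hGdef
  have hG : Measurable G := hF.comp Real.measurable_cos
  have hG1 : ∀ τ, ‖G τ‖ ≤ 1 := fun τ => hF1 _
  have hGe : ∀ τ, G (-τ) = G τ := fun τ => by simp [hGdef]
  set A : ℝ → 𝕜 := fun k => ∫ τ in -Real.pi..Real.pi, Real.cos (k * τ) • G τ with hA
  set K : 𝕜 := f (-1)
    + (Real.pi⁻¹ : ℝ) • ∫ τ in (0 : ℝ)..Real.pi, (τ * Real.sin τ) • F (Real.cos τ) with hK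
  set T₁ : ℝ → ℝ := fun s => ∑ m ∈ Finset.range (n - 1), v m * Real.sin ((m + 1) * s) with hT₁
  set T₂ : ℝ → ℝ := fun s => ∑ m ∈ Finset.range n, v' m * Real.cos (m * s) with hT₂
  have hT₁c : Continuous T₁ := by fun_prop
  have hT₂c : Continuous T₂ := by fun_prop
  have hT₁p : Function.Periodic T₁ (2 * Real.pi) := fun s => by
    refine Finset.sum_congr rfl fun m _ => ?_
    rw [mul_add]
    have := Real.sin_add_nat_mul_two_pi ((m + 1) * s) (m + 1)
    push_cast at this
    rw [this]
  have hT₂p : Function.Periodic T₂ (2 * Real.pi) := fun s => by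
    refine Finset.sum_congr rfl fun m _ => ?_
    rw [mul_add, Real.cos_add_nat_mul_two_pi]
  have hci : ∀ {φ : ℝ → ℝ}, Continuous φ →
      IntervalIntegrable (fun τ => φ τ • G τ) volume (-Real.pi) Real.pi := fun {φ} hφ => by
    have h1 : IntervalIntegrable G volume (-Real.pi) Real.pi := by
      simpa using intervalIntegrable_smul_of_bounded hG hG1 (φ := fun _ => 1) measurable_const
        (C := 1) (by simp) (-Real.pi) Real.pi
    exact h1.continuousOn_smul hφ.continuousOn
  have hI₁ : ∀ t, ∫ τ in -Real.pi..Real.pi, T₁ (t - τ) • G τ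
      = ∑ m ∈ Finset.range (n - 1), (v m * Real.sin ((m + 1) * t)) • A (m + 1) := by
    intro t
    simp only [hT₁, Finset.sum_smul]
    rw [intervalIntegral.integral_finsetSum fun m _ => hci (by fun_prop)]
    refine Finset.sum_congr rfl fun m _ => ?_
    simp only [mul_smul]
    rw [intervalIntegral.integral_smul, integral_sin_smul_even hG hG1 hGe]
  have hI₂ : ∀ t, ∫ τ in -Real.pi..Real.pi, T₂ (t - τ) • G τ
      = ∑ m ∈ Finset.range n, (v' m * Real.cos (m * t)) • A m := by
    intro t
    simp only [hT₂, Finset.sum_smul]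
    rw [intervalIntegral.integral_finsetSum fun m _ => hci (by fun_prop)]
    refine Finset.sum_congr rfl fun m _ => ?_
    simp only [mul_smul]
    rw [intervalIntegral.integral_smul, integral_cos_smul_even hG hG1 hGe]
  -- With `x = cos t`, `sin t * sin ((m + 1) t) = (1 - x²) U_m(x)` has degree `m + 2 ≤ n`, and `cos
  -- t * cos (m t) = x T_m(x)` has degree at most `m + 1 ≤ n`.
  set Q₁ : 𝕜[X] := ∑ m ∈ Finset.range (n - 1),
    C (v m • A (m + 1)) * ((1 - X ^ 2) * Chebyshev.U 𝕜 m) with hQ₁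
  set Q₂ : 𝕜[X] := ∑ m ∈ Finset.range n, C (v' m • A m) * (X * Chebyshev.T 𝕜 m) with hQ₂
  refine ⟨C K - C ((Real.pi⁻¹ : ℝ) : 𝕜) * (Q₁ - Q₂), ?_, ?_⟩
  · have h1 : Q₁.natDegree ≤ n := by
      refine natDegree_sum_le_of_forall_le _ _ fun m hm => (natDegree_C_mul_le _ _).trans ?_
      have hm' := Finset.mem_range.1 hm
      refine natDegree_mul_le.trans ?_
      have h2 : (1 - X ^ 2 : 𝕜[X]).natDegree ≤ 2 := (natDegree_sub_le _ _).trans (by simp)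
      rw [Chebyshev.natDegree_U_natCast]
      omega
    have h2 : Q₂.natDegree ≤ n := by
      refine natDegree_sum_le_of_forall_le _ _ fun m hm => (natDegree_C_mul_le _ _).trans ?_
      have hm' := Finset.mem_range.1 hm
      refine natDegree_mul_le.trans ?_
      rw [Chebyshev.natDegree_T, natDegree_X, Int.natAbs_natCast]
      omega
    refine (natDegree_sub_le _ _).trans (max_le (by simp) ((natDegree_C_mul_le _ _).trans ?_))
    exact (natDegree_sub_le _ _).trans (max_le h1 h2)
  · intro x hx
    obtain ⟨t, ht, rfl⟩ : ∃ t ∈ Icc 0 Real.pi, Real.cos t = x :=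
      ⟨Real.arccos x, ⟨Real.arccos_nonneg x, Real.arccos_le_pi x⟩, Real.cos_arccos hx.1 hx.2⟩
    have hsin : 0 ≤ Real.sin t := Real.sin_nonneg_of_mem_Icc ht
    have hQ₁e : Q₁.eval ((Real.cos t : ℝ) : 𝕜)
        = Real.sin t • ∫ τ in -Real.pi..Real.pi, T₁ (t - τ) • G τ := by
      rw [hI₁, hQ₁, eval_finsetSum, Finset.smul_sum]
      refine Finset.sum_congr rfl fun m _ => ?_
      have hU := Chebyshev.algebraMap_eval_U (R' := 𝕜) (Real.cos t) m
      have hU' := Chebyshev.U_real_cos t m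
      push_cast at hU'
      have e : Real.sin t * (v m * Real.sin ((m + 1) * t))
          = v m * ((1 - Real.cos t ^ 2) * (Chebyshev.U ℝ m).eval (Real.cos t)) := by
        rw [← hU', ← Real.sin_sq]; ring
      rw [smul_smul, e]
      simp only [eval_mul, eval_C, eval_sub, eval_one, eval_pow, eval_X, RCLike.real_smul_eq_coe_mul]
      rw [RCLike.algebraMap_eq_ofReal] at hU
      rw [← hU]
      push_cast
      ring
    have hQ₂e : Q₂.eval ((Real.cos t : ℝ) : 𝕜)
        = Real.cos t • ∫ τ in -Real.pi..Real.pi, T₂ (t - τ) • G τ := by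
      rw [hI₂, hQ₂, eval_finsetSum, Finset.smul_sum]
      refine Finset.sum_congr rfl fun m _ => ?_
      have hU := Chebyshev.algebraMap_eval_T (R' := 𝕜) (Real.cos t) m
      have hU' := Chebyshev.T_real_cos t m
      push_cast at hU'
      rw [smul_smul, ← hU']
      simp only [eval_mul, eval_C, eval_X, RCLike.real_smul_eq_coe_mul]
      rw [RCLike.algebraMap_eq_ofReal] at hU
      rw [← hU]
      push_cast
      ring
    set D₁ : ℝ → ℝ := fun τ => sawtooth (t - τ) * Real.cos (t - τ) - T₁ (t - τ) with hD₁
    set D₂ : ℝ → ℝ := fun τ => sawtooth (t - τ) * Real.sin (t - τ) - T₂ (t - τ) with hD₂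
    have hsawm : Measurable fun τ => sawtooth (t - τ) :=
      measurable_sawtooth.comp (measurable_const.sub measurable_id)
    have hsawi : IntervalIntegrable (fun τ => sawtooth (t - τ)) volume (-Real.pi) Real.pi := by
      rw [intervalIntegrable_iff]
      exact Measure.integrableOn_of_bounded (by simp [uIoc]) hsawm.aestronglyMeasurable
        (Filter.Eventually.of_forall fun u => abs_sawtooth_le _)
    have hD₁i : IntervalIntegrable D₁ volume (-Real.pi) Real.pi :=
      (hsawi.mul_continuousOn (by fun_prop)).sub (Continuous.intervalIntegrable (by fun_prop) _ _)
    have hD₂i : IntervalIntegrable D₂ volume (-Real.pi) Real.pi :=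
      (hsawi.mul_continuousOn (by fun_prop)).sub (Continuous.intervalIntegrable (by fun_prop) _ _)
    have hS := integral_sawtooth_smul hF hF1 ht
    have hSi : IntervalIntegrable (fun τ => (sawtooth (t - τ) * Real.sin τ) • G τ) volume
        (-Real.pi) Real.pi := by
      refine intervalIntegrable_smul_of_bounded hG hG1 (hsawm.mul Real.measurable_sin)
        (C := Real.pi / 2 * 1) (fun u => ?_) _ _
      rw [Pi.mul_apply, abs_mul]
      gcongr
      · exact abs_sawtooth_le _
      · exact Real.abs_sin_le_one u
    have hrep : f (Real.cos t)
        - (C K - C ((Real.pi⁻¹ : ℝ) : 𝕜) * (Q₁ - Q₂)).eval ((Real.cos t : ℝ) : 𝕜)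
        = -(Real.pi⁻¹ • ∫ τ in -Real.pi..Real.pi,
          (Real.sin t * D₁ τ - Real.cos t * D₂ τ) • G τ) := by
      have e : ∀ τ, (Real.sin t * D₁ τ - Real.cos t * D₂ τ) • G τ
          = (sawtooth (t - τ) * Real.sin τ) • G τ
            - ((Real.sin t * T₁ (t - τ)) • G τ - (Real.cos t * T₂ (t - τ)) • G τ) := by
        intro τ
        rw [← sub_smul, ← sub_smul]
        congr 1
        -- This splitting creates the weights `sin t` and `cos t`, the source of the pointwise form
        -- of the bound.
        have : Real.sin τ = Real.sin t * Real.cos (t - τ) - Real.cos t * Real.sin (t - τ) := by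
          rw [← Real.sin_sub]; congr 1; ring
        rw [hD₁, hD₂, this]
        ring
      have i1 := hci (φ := fun τ => Real.sin t * T₁ (t - τ)) (by fun_prop)
      have i2 := hci (φ := fun τ => Real.cos t * T₂ (t - τ)) (by fun_prop)
      simp only [e]
      rw [intervalIntegral.integral_sub hSi (i1.sub i2), intervalIntegral.integral_sub i1 i2]
      simp only [mul_smul (Real.sin t), mul_smul (Real.cos t)]
      rw [intervalIntegral.integral_smul, intervalIntegral.integral_smul, ← hQ₁e, ← hQ₂e, hS,
        hfF _ hx, hK]
      simp only [eval_sub, eval_mul, eval_C, smul_sub, smul_smul]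
      rw [inv_mul_cancel₀ hpi.ne', one_smul]
      simp only [RCLike.real_smul_eq_coe_mul]
      ring
    have hbound : ‖∫ τ in -Real.pi..Real.pi, (Real.sin t * D₁ τ - Real.cos t * D₂ τ) • G τ‖
        ≤ Real.sin t * (∫ τ in -Real.pi..Real.pi, |D₁ τ|)
          + |Real.cos t| * ∫ τ in -Real.pi..Real.pi, |D₂ τ| := by
      rw [← intervalIntegral.integral_const_mul, ← intervalIntegral.integral_const_mul,
        ← intervalIntegral.integral_add (hD₁i.abs.const_mul _) (hD₂i.abs.const_mul _)]
      refine intervalIntegral.norm_integral_le_of_norm_le (by linarith)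
        (Filter.Eventually.of_forall fun τ _ => ?_)
        ((hD₁i.abs.const_mul _).add (hD₂i.abs.const_mul _))
      rw [norm_smul, Real.norm_eq_abs]
      calc _ ≤ |Real.sin t * D₁ τ - Real.cos t * D₂ τ| * 1 := by gcongr; exact hG1 τ
        _ ≤ |Real.sin t * D₁ τ| + |Real.cos t * D₂ τ| := by rw [mul_one]; exact abs_sub _ _
        _ = _ := by rw [abs_mul, abs_mul, abs_of_nonneg hsin]
    rw [integral_abs_sawtooth_mul_sub _ _ Real.cos_periodic hT₁p, hv,
      integral_abs_sawtooth_mul_sub _ _ Real.sin_periodic hT₂p, hv'] at hbound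
    rw [hrep, norm_neg, norm_smul, Real.sqrt_sq_eq_abs, ← Real.sin_sq, Real.sqrt_sq hsin,
      Real.norm_eq_abs, abs_of_pos (inv_pos.2 hpi), inv_mul_le_iff₀ hpi]
    linarith
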